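/- **Model (Bandit Social Learning).** There are two arms with mean rewards $\mu_1,\mu_2\in[0,1]$, $T$ rounds, and $N_0$ initial samples of each arm $a$, which are independent Bernoulli draws with mean $\mu_a$. In each round $t=1,\dots,T$ a new agent observes the history $h_t$ (the initial samples of both arms, and the chosen arms and rewards of all previous rounds). The agent draws, from a law that depends only on $h_t$ (and may differ between agents), an index $\mathrm{Ind}_{a,t}\in\mathbb{R}$ for each arm $a$, and chooses an arm $a_t$ with a largest index, breaking ties uniformly at random. Then the reward of round $t$ is a fresh Bernoulli draw with mean $\mu_{a_t}$. Let $n_{a,t}$ and $\hat\mu_{a,t}$ be the number and the average reward of the samples of arm $a$ in $h_t$, the initial ones included. For $\eta\ge 0$, agent $t$ is *$\eta$-confident* if, for every history $h_t$, almost surely for both arms $a$, $$\mathrm{Ind}_{a,t}\in\Big[\max\{0,\ \hat\mu_{a,t}-\sqrt{\eta/n_{a,t}}\},\ \min\{1,\ \hat\mu_{a,t}+\sqrt{\eta/n_{a,t}}\}\Big].$$ The *$0$-sampling failure* is the event that all $T$ agents choose arm $2$, and $\mathrm{Regret}(T)=\max(\mu_1,\mu_2)\,T-\mathbb{E}\big[\sum_{t=1}^T\mu_{a_t}\big]$.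 **Corollary 3.3.** For every $c\in(0,\tfrac12)$ there is a constant $C_c>0$, and for every $K>0$ there is a constant $\alpha_{c,K}>0$, such that the following holds. Let $\eta\ge 0$, suppose that all $T$ agents are $\eta$-confident, that $c<\mu_2<\mu_1<1-c$, and that $N_0\ge 64\,\eta/c^2+1/c$. Put $\Delta=\mu_1-\mu_2$ and suppose that $\Delta<K/\sqrt{N_0}$. Then the $0$-sampling failure occurs with probability at least $$p_{\mathrm{fail}}=\alpha_{c,K}\,\big(\Delta+\sqrt{\eta/N_0}\big)\,e^{-C_c\,\eta},$$ and consequently $\mathrm{Regret}(T)\ \ge\ \Delta\cdot p_{\mathrm{fail}}\cdot T$. -/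

import Mathlib

open MeasureTheory ProbabilityTheory

namespace BanditSocialLearning

/-- The good arm (arm 1 in the usual one-based numbering of the two arms). -/
abbrev goodArm : Fin 2 := 0

/-- The bad arm (arm 2 in the usual one-based numbering of the two arms). -/
abbrev badArm : Fin 2 := 1

/-- A history with `N₀` initial samples of each arm and `t` completed rounds. The first component
holds the rewards of the initial samples, `h.1 a i` being the `i`-th initial sample of arm `a`;
the second one holds, for each completed round, the chosen arm and the realized reward.
Rewards are Bernoulli: `true` stands for reward `1` and `false` for reward `0`. -/
abbrev History (N₀ t : ℕ) : Type :=
  (Fin 2 → Fin N₀ → Bool) × (Fin t → Fin 2 × Bool)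

/-- The numerical value of a realized reward. -/
def rewardValue (r : Bool) : ℝ := if r then 1 else 0

/-- The number of samples of arm `a` in the history (including the initial samples). -/
def numSamples {N₀ t : ℕ} (h : History N₀ t) (a : Fin 2) : ℕ :=
  N₀ + (Finset.univ.filter fun s : Fin t => (h.2 s).1 = a).card

/-- The average reward of arm `a` in the history (including the initial samples). -/
noncomputable def avgReward {N₀ t : ℕ} (h : History N₀ t) (a : Fin 2) : ℝ :=
  ((∑ i : Fin N₀, rewardValue (h.1 a i)) +
      ∑ s : Fin t, if (h.2 s).1 = a then rewardValue (h.2 s).2 else 0) / numSamples h a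

/-- The (truncated) upper confidence bound with parameter `η`. -/
noncomputable def ucb {N₀ t : ℕ} (η : ℝ) (h : History N₀ t) (a : Fin 2) : ℝ :=
  min 1 (avgReward h a + √(η / numSamples h a))

/-- The (truncated) lower confidence bound with parameter `η`. -/
noncomputable def lcb {N₀ t : ℕ} (η : ℝ) (h : History N₀ t) (a : Fin 2) : ℝ :=
  max 0 (avgReward h a - √(η / numSamples h a))

/-- A (possibly randomized) behavioral type of an agent who observes `t` completed rounds: it maps
each history to the joint law of the indices of the two arms. Histories with given `N₀` and `t`
form a finite set, so there is no measurability condition; a deterministic agent uses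
Dirac measures. -/
abbrev BehavioralType (N₀ t : ℕ) : Type :=
  History N₀ t → ProbabilityMeasure (Fin 2 → ℝ)

/-- The agent is `η`-confident: after every history, the (drawn) index of each arm lies in the
`η`-confidence interval of that arm, almost surely. -/
def IsConfident {N₀ t : ℕ} (η : ℝ) (b : BehavioralType N₀ t) : Prop :=
  ∀ h : History N₀ t, ∀ᵐ ind ∂(b h : Measure (Fin 2 → ℝ)),
    ∀ a : Fin 2, ind a ∈ Set.Icc (lcb η h a) (ucb η h a)

/-- The law of the chosen arm given the indices: an arm with a largest index,
ties being broken uniformly at random. -/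
noncomputable def choiceLaw (ind : Fin 2 → ℝ) : Measure (Fin 2) :=
  uniformOn {a | ∀ a' : Fin 2, ind a' ≤ ind a}

/-- The law of the history after one more round, given the history `h` so far: the agent draws the
indices, chooses an arm `a` accordingly, and the reward is a fresh Bernoulli draw with
mean `μ a`. -/
noncomputable def roundLaw {N₀ t : ℕ} (μ : Fin 2 → unitInterval) (b : BehavioralType N₀ t)
    (h : History N₀ t) : Measure (History N₀ (t + 1)) :=
  ((b h : Measure (Fin 2 → ℝ)).bind choiceLaw).bind fun a =>
    (bernoulliMeasure true false (μ a)).map fun r => (h.1, Fin.snoc h.2 (a, r))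

/-- The law of the history after `t` rounds of the protocol with mean rewards `μ`, where
`agents s` is the behavioral type of the agent who arrives after `s` completed rounds. The initial
samples are independent Bernoulli draws. -/
noncomputable def historyLaw {N₀ : ℕ} (μ : Fin 2 → unitInterval)
    (agents : (s : ℕ) → BehavioralType N₀ s) : (t : ℕ) → Measure (History N₀ t)
  | 0 => (Measure.pi fun a : Fin 2 => Measure.pi fun _ : Fin N₀ =>
      bernoulliMeasure true false (μ a)).map fun init => (init, Fin.elim0)
  | t + 1 => (historyLaw μ agents t).bind (roundLaw μ (agents t))

/-- The `n`-sampling failure in `T` rounds: all but at most `n` agents choose the bad arm. -/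
def samplingFailure (N₀ T n : ℕ) : Set (History N₀ T) :=
  {h | (Finset.univ.filter fun s : Fin T => (h.2 s).1 ≠ badArm).card ≤ n}

/-- Regret after `T` rounds: `μ* · T - E[∑ₜ μ (aₜ)]`, where `μ*` is the larger mean reward. -/
noncomputable def regret {N₀ : ℕ} (μ : Fin 2 → unitInterval)
    (agents : (s : ℕ) → BehavioralType N₀ s) (T : ℕ) : ℝ :=
  max (μ goodArm : ℝ) (μ badArm) * T -
    ∫ h, ∑ s : Fin T, (μ (h.2 s).1 : ℝ) ∂(historyLaw μ agents T)

end BanditSocialLearning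

namespace BanditSocialLearning

/-! Failure is forced by two independent events: the initial average of the good arm is at most `τ`,
and the running average of the bad arm stays above a level `m = μ badArm - y` with `m ≥ τ +
2√(η/N₀)`. Then the confidence intervals are separated, so every confident agent picks the bad arm
and the good arm's average never recovers.

The first event is bounded below by a reverse Chernoff estimate (`exp_le_sampleLaw_lower_tail`:
Cauchy–Schwarz change of measure plus Chebyshev). For the second, the excess of the bad arm's total
over `m` per sample is a random walk with drift `y`, and `exp (-(y * excess))` is a supermartingale.
Truncating `1 - exp (-(y * excess))` at zero gives a `potential` whose mean never decreases over
rounds; it is at most the failure indicator at time `T`, and of order `y` under the initial law.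
With `y` proportional to `Δ + √(η/N₀)` this yields the linear factor. -/

/-! ### Choice law, round law, and regret on the failure event -/

lemma lintegral_bernoulliMeasure {X : Type*} [MeasurableSpace X] [MeasurableSingletonClass X]
    (x y : X) (p : unitInterval) (f : X → ENNReal) :
    ∫⁻ z, f z ∂(bernoulliMeasure x y p) =
      ENNReal.ofReal p * f x + ENNReal.ofReal (1 - p) * f y := by
  rw [bernoulliMeasure_def, lintegral_add_measure, lintegral_smul_measure, lintegral_smul_measure,
    lintegral_dirac, lintegral_dirac]
  have h1 : ((unitInterval.toNNReal p : NNReal) : ENNReal) = ENNReal.ofReal p := by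
    rw [ENNReal.ofReal, ← Real.toNNReal_coe (r := unitInterval.toNNReal p)]; rfl
  have h2 : ((unitInterval.toNNReal (unitInterval.symm p) : NNReal) : ENNReal) =
      ENNReal.ofReal (1 - p) := by
    rw [ENNReal.ofReal, ← Real.toNNReal_coe (r := unitInterval.toNNReal _)]; rfl
  rw [← h1, ← h2]; rfl

lemma choiceLaw_of_lt {ind : Fin 2 → ℝ} (h : ind goodArm < ind badArm) :
    choiceLaw ind = Measure.dirac badArm := by
  have : {a : Fin 2 | ∀ a' : Fin 2, ind a' ≤ ind a} = {badArm} := by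
    ext a
    fin_cases a
    · simpa [Fin.forall_fin_two] using h
    · simpa [Fin.forall_fin_two] using h.le
  rw [choiceLaw, this]
  ext s hs
  classical
  rw [uniformOn_singleton, Measure.dirac_apply' _ hs]
  rfl

lemma choiceLaw_of_gt {ind : Fin 2 → ℝ} (h : ind badArm < ind goodArm) :
    choiceLaw ind = Measure.dirac goodArm := by
  have : {a : Fin 2 | ∀ a' : Fin 2, ind a' ≤ ind a} = {goodArm} := by
    ext a
    fin_cases a
    · simpa [Fin.forall_fin_two] using h.le
    · simpa [Fin.forall_fin_two] using h
  rw [choiceLaw, this]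
  ext s hs
  classical
  rw [uniformOn_singleton, Measure.dirac_apply' _ hs]
  rfl

lemma choiceLaw_of_eq {ind : Fin 2 → ℝ} (h : ind goodArm = ind badArm) :
    choiceLaw ind = uniformOn Set.univ := by
  have : {a : Fin 2 | ∀ a' : Fin 2, ind a' ≤ ind a} = Set.univ := by
    ext a
    fin_cases a
    · simpa [Fin.forall_fin_two] using h.ge
    · simpa [Fin.forall_fin_two] using h.le
  rw [choiceLaw, this]

instance isProbabilityMeasure_choiceLaw (ind : Fin 2 → ℝ) :
    IsProbabilityMeasure (choiceLaw ind) := by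
  rcases lt_trichotomy (ind goodArm) (ind badArm) with h | h | h
  · rw [choiceLaw_of_lt h]; infer_instance
  · rw [choiceLaw_of_eq h]; exact isProbabilityMeasure_uniformOn Set.finite_univ Set.univ_nonempty
  · rw [choiceLaw_of_gt h]; infer_instance

lemma measurable_choiceLaw : Measurable choiceLaw := by
  classical
  have : choiceLaw = fun ind : Fin 2 → ℝ =>
      if ind goodArm < ind badArm then Measure.dirac badArm
      else if ind badArm < ind goodArm then Measure.dirac goodArm else uniformOn Set.univ := by
    ext1 ind
    split_ifs with h₁ h₂
    · exact choiceLaw_of_lt h₁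
    · exact choiceLaw_of_gt h₂
    · exact choiceLaw_of_eq (le_antisymm (not_lt.1 h₂) (not_lt.1 h₁))
  rw [this]
  refine Measurable.ite (measurableSet_lt (by fun_prop) (by fun_prop)) measurable_const
    (Measurable.ite (measurableSet_lt (by fun_prop) (by fun_prop)) measurable_const
      measurable_const)

instance isProbabilityMeasure_roundLaw {N₀ t : ℕ} (μ : Fin 2 → unitInterval)
    (b : BehavioralType N₀ t) (h : History N₀ t) : IsProbabilityMeasure (roundLaw μ b h) := by
  have : IsProbabilityMeasure ((b h : Measure (Fin 2 → ℝ)).bind choiceLaw) :=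
    isProbabilityMeasure_bind measurable_choiceLaw.aemeasurable (ae_of_all _ inferInstance)
  refine isProbabilityMeasure_bind (Measurable.of_discrete).aemeasurable (ae_of_all _ fun a => ?_)
  exact Measure.isProbabilityMeasure_map (Measurable.of_discrete).aemeasurable

instance isProbabilityMeasure_historyLaw {N₀ : ℕ} (μ : Fin 2 → unitInterval)
    (agents : (s : ℕ) → BehavioralType N₀ s) (t : ℕ) :
    IsProbabilityMeasure (historyLaw μ agents t) := by
  induction t with
  | zero => exact Measure.isProbabilityMeasure_map (Measurable.of_discrete).aemeasurable
  | succ t ih =>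
    exact isProbabilityMeasure_bind (Measurable.of_discrete).aemeasurable
      (ae_of_all _ inferInstance)

/-- If the confidence interval of the bad arm lies above that of the good arm, a confident agent
chooses the bad arm. -/
lemma roundLaw_of_ucb_lt_lcb {N₀ t : ℕ} {η : ℝ} (μ : Fin 2 → unitInterval)
    {b : BehavioralType N₀ t} (hb : IsConfident η b) {h : History N₀ t}
    (hlt : ucb η h goodArm < lcb η h badArm) :
    roundLaw μ b h = (bernoulliMeasure true false (μ badArm)).map
      fun r => ((h.1, Fin.snoc h.2 (badArm, r)) : History N₀ (t + 1)) := by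
  have hchoice : (b h : Measure (Fin 2 → ℝ)).bind choiceLaw = Measure.dirac badArm := by
    rw [Measure.bind_congr_right (g := fun _ => Measure.dirac badArm), Measure.bind_const]
    · simp
    · filter_upwards [hb h] with ind hind
      exact choiceLaw_of_lt ((hind goodArm).2.trans_lt (hlt.trans_le (hind badArm).1))
  rw [roundLaw, hchoice, Measure.dirac_bind (Measurable.of_discrete)]

/-- The regret is at least the regret on the `0`-sampling failure event. -/
lemma mul_samplingFailure_le_regret {N₀ : ℕ} (μ : Fin 2 → unitInterval)
    (agents : (s : ℕ) → BehavioralType N₀ s) (T : ℕ)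
    (hμ : (μ badArm : ℝ) ≤ μ goodArm) :
    ((μ goodArm : ℝ) - μ badArm) * (historyLaw μ agents T).real (samplingFailure N₀ T 0) * T ≤
      regret μ agents T := by
  classical
  have hpt : ∀ h : History N₀ T, ∑ s : Fin T, (μ (h.2 s).1 : ℝ) ≤
      (μ goodArm : ℝ) * T - (samplingFailure N₀ T 0).indicator
        (fun _ => ((μ goodArm : ℝ) - μ badArm) * T) h := by
    intro h
    by_cases hh : h ∈ samplingFailure N₀ T 0
    · rw [Set.indicator_of_mem hh]
      have : ∀ s, (h.2 s).1 = badArm := by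
        simpa [samplingFailure, Finset.filter_eq_empty_iff] using hh
      simp [this]
      linarith
    · rw [Set.indicator_of_notMem hh]
      calc ∑ s : Fin T, (μ (h.2 s).1 : ℝ) ≤ ∑ _s : Fin T, (μ goodArm : ℝ) := by
            refine Finset.sum_le_sum fun s _ => ?_
            generalize (h.2 s).1 = a
            fin_cases a
            · exact le_rfl
            · exact hμ
        _ = _ := by simp [mul_comm]
  have hint := integral_mono (μ := historyLaw μ agents T) Integrable.of_finite
    Integrable.of_finite hpt
  rw [integral_sub Integrable.of_finite Integrable.of_finite,
    integral_indicator_const _ (Set.toFinite _).measurableSet, integral_const] at hint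
  simp only [probReal_univ, smul_eq_mul, one_mul] at hint
  rw [regret, max_eq_left hμ]
  nlinarith

/-! ### Reverse Chernoff bound by change of measure -/

/-- The law of `N` independent Bernoulli rewards with mean `p`. -/
noncomputable abbrev sampleLaw (N : ℕ) (p : unitInterval) : Measure (Fin N → Bool) :=
  Measure.pi fun _ : Fin N => bernoulliMeasure true false p

lemma bernoulliMeasure_real_singleton (p : unitInterval) (r : Bool) :
    (bernoulliMeasure true false p).real {r} = if r then (p : ℝ) else 1 - p := by
  cases r <;> simp

lemma sampleLaw_real_singleton (N : ℕ) (p : unitInterval) (ω : Fin N → Bool) :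
    (sampleLaw N p).real {ω} = ∏ i, if ω i then (p : ℝ) else 1 - p := by
  rw [measureReal_def, Measure.pi_singleton, ENNReal.toReal_prod]
  exact Finset.prod_congr rfl fun i _ => bernoulliMeasure_real_singleton p (ω i)

/-- Change of measure by the Cauchy–Schwarz inequality: the second moment of the likelihood ratio
of two Bernoulli samples is at most `exp (N (p - q)² / (p (1 - p)))`. -/
lemma sampleLaw_real_sq_le (N : ℕ) {p : unitInterval} (q : unitInterval)
    (hp₀ : 0 < (p : ℝ)) (hp₁ : (p : ℝ) < 1) (A : Set (Fin N → Bool)) :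
    (sampleLaw N q).real A ^ 2 ≤ (sampleLaw N p).real A *
      Real.exp (N * ((p - q : ℝ) ^ 2 / (p * (1 - p)))) := by
  classical
  have hp₁' : 0 < 1 - (p : ℝ) := by linarith
  let w : unitInterval → Bool → ℝ := fun p r => if r then (p : ℝ) else 1 - p
  have hw : ∀ r, 0 < w p r := by intro r; cases r <;> simp [w, hp₀, hp₁]
  have hsum : ∀ p : unitInterval,
      (sampleLaw N p).real A = ∑ ω ∈ A.toFinset, ∏ i, w p (ω i) := by
    intro p
    conv_lhs => rw [← Set.coe_toFinset A, ← sum_measureReal_singleton]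
    exact Finset.sum_congr rfl fun ω _ => sampleLaw_real_singleton N p ω
  have hprod : ∀ ω : Fin N → Bool, 0 < ∏ i, w p (ω i) :=
    fun ω => Finset.prod_pos fun i _ => hw _
  have hratio : ∑ ω : Fin N → Bool, ∏ i, (w q (ω i) ^ 2 / w p (ω i)) ≤
      Real.exp (N * ((p - q : ℝ) ^ 2 / (p * (1 - p)))) := by
    rw [← Fintype.piFinset_univ, Finset.sum_prod_piFinset (Finset.univ : Finset Bool)
      (fun _ r => w q r ^ 2 / w p r), Finset.prod_const, Finset.card_fin, Real.exp_nat_mul]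
    refine pow_le_pow_left₀ (Finset.sum_nonneg fun r _ => div_nonneg (sq_nonneg _) (hw r).le) ?_ N
    -- The second moment factorizes over samples; each factor is one plus the χ²-divergence.
    have : ∑ r : Bool, w q r ^ 2 / w p r = (p - q : ℝ) ^ 2 / (p * (1 - p)) + 1 := by
      simp only [Fintype.sum_bool, w]
      simp
      field_simp
      ring
    rw [this]
    exact Real.add_one_le_exp _
  calc (sampleLaw N q).real A ^ 2 = (∑ ω ∈ A.toFinset, ∏ i, w q (ω i)) ^ 2 := by rw [hsum q]
    _ ≤ (∑ ω ∈ A.toFinset, ∏ i, w p (ω i)) *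
        ∑ ω ∈ A.toFinset, ∏ i, (w q (ω i) ^ 2 / w p (ω i)) := by
      refine Finset.sum_sq_le_sum_mul_sum_of_sq_le_mul _ (fun ω _ => (hprod ω).le)
        (fun ω _ => Finset.prod_nonneg fun i _ => div_nonneg (sq_nonneg _) (hw _).le)
        (fun ω _ => le_of_eq ?_)
      rw [← Finset.prod_mul_distrib, ← Finset.prod_pow]
      exact Finset.prod_congr rfl fun i _ => (mul_div_cancel₀ _ (hw _).ne').symm
    _ ≤ _ := by
      rw [hsum p]
      refine mul_le_mul_of_nonneg_left (le_trans ?_ hratio)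
        (Finset.sum_nonneg fun ω _ => (hprod ω).le)
      exact Finset.sum_le_sum_of_subset_of_nonneg (Finset.subset_univ _)
        fun ω _ _ => Finset.prod_nonneg fun i _ => div_nonneg (sq_nonneg _) (hw _).le

lemma integral_rewardValue (q : unitInterval) :
    ∫ r, rewardValue r ∂(bernoulliMeasure true false q) = q := by
  simp [integral_bernoulliMeasure, rewardValue]

lemma variance_rewardValue_le (q : unitInterval) :
    variance rewardValue (bernoulliMeasure true false q) ≤ 1 / 4 := by
  rw [variance_eq_integral (Measurable.of_discrete).aemeasurable, integral_rewardValue,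
    integral_bernoulliMeasure]
  simp only [rewardValue, smul_eq_mul]
  norm_num
  nlinarith [sq_nonneg ((q : ℝ) - 1 / 2)]

/-- Chebyshev's inequality for Bernoulli samples: the probability that the sum exceeds its mean by
more than `√N` is at most `1/4`. -/
lemma three_quarters_le_sampleLaw (N : ℕ) (hN : 0 < N) (q : unitInterval) {τ : ℝ}
    (hq : (q : ℝ) + 1 / √(N : ℝ) ≤ τ) :
    3 / 4 ≤ (sampleLaw N q).real {ω | ∑ i, rewardValue (ω i) ≤ N * τ} := by
  have hN' : (0 : ℝ) < N := by exact_mod_cast hN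
  have hs : 0 < √(N : ℝ) := Real.sqrt_pos.2 hN'
  have hss : √(N : ℝ) * √(N : ℝ) = N := Real.mul_self_sqrt hN'.le
  let X : (Fin N → Bool) → ℝ := ∑ i, fun ω : Fin N → Bool => rewardValue (ω i)
  have hX : ∀ ω, X ω = ∑ i, rewardValue (ω i) := fun ω => by simp [X]
  have hmean : ∫ ω, X ω ∂(sampleLaw N q) = N * q := by
    simp only [hX]
    rw [integral_finsetSum _ fun i _ => Integrable.of_finite]
    have : ∀ i : Fin N, ∫ ω, rewardValue (ω i) ∂(sampleLaw N q) = q := by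
      intro i
      rw [← integral_rewardValue q]
      exact integral_comp_eval (μ := fun _ : Fin N => bernoulliMeasure true false q)
        (f := rewardValue) (Measurable.of_discrete).aestronglyMeasurable
    simp [this]
  have hvar : variance X (sampleLaw N q) ≤ N / 4 := by
    rw [variance_sum_pi fun i => MemLp.of_discrete]
    calc _ ≤ ∑ _i : Fin N, (1 / 4 : ℝ) := Finset.sum_le_sum fun i _ => variance_rewardValue_le q
      _ = _ := by simp; ring
  have hcheb := meas_ge_le_variance_div_sq (μ := sampleLaw N q) (X := X) MemLp.of_discrete hs
  rw [hmean, Real.sq_sqrt hN'.le] at hcheb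
  have hbad : (sampleLaw N q).real {ω | √(N : ℝ) ≤ |X ω - N * q|} ≤ 1 / 4 := by
    rw [measureReal_def]
    refine ENNReal.toReal_le_of_le_ofReal (by norm_num) (hcheb.trans (ENNReal.ofReal_le_ofReal ?_))
    rw [div_le_iff₀ hN']
    linarith
  have hcompl := probReal_compl_eq_one_sub (μ := sampleLaw N q)
    (Set.toFinite {ω | √(N : ℝ) ≤ |X ω - N * q|}).measurableSet
  calc (3 / 4 : ℝ) ≤ (sampleLaw N q).real {ω | √(N : ℝ) ≤ |X ω - N * q|}ᶜ := by linarith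
    _ ≤ _ := by
      refine measureReal_mono (fun ω hω => ?_)
      simp only [Set.mem_compl_iff, Set.mem_ofPred_eq, not_le] at hω ⊢
      rw [← hX]
      have h1 := (le_abs_self _).trans_lt hω
      have h2 : (N : ℝ) * (q + 1 / √(N : ℝ)) = N * q + √(N : ℝ) := by
        rw [mul_add, mul_one_div, (div_eq_iff hs.ne').2 hss.symm]
      nlinarith [mul_le_mul_of_nonneg_left hq hN'.le]

/-- A reverse Chernoff bound for the lower tail of Bernoulli samples. -/
lemma exp_le_sampleLaw_lower_tail (N : ℕ) (hN : 0 < N) {p : unitInterval}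
    (hp₀ : 0 < (p : ℝ)) (hp₁ : (p : ℝ) < 1) {τ : ℝ} (hτ₀ : 0 ≤ τ) (hτ : τ ≤ p) :
    9 / 16 * Real.exp (-((√(N : ℝ) * (p - τ) + 1) ^ 2 / (p * (1 - p)))) ≤
      (sampleLaw N p).real {ω | ∑ i, rewardValue (ω i) ≤ N * τ} := by
  have hN' : (0 : ℝ) < N := by exact_mod_cast hN
  have hs : 0 < √(N : ℝ) := Real.sqrt_pos.2 hN'
  have hss : √(N : ℝ) ^ 2 = N := Real.sq_sqrt hN'.le
  have hp₁' : 0 < 1 - (p : ℝ) := by linarith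
  set A : Set (Fin N → Bool) := {ω | ∑ i, rewardValue (ω i) ≤ N * τ}
  -- Shift the mean to `τ - 1/√N`, where `A` is typical. If that is negative, `q = 0` works: all
  -- samples then vanish.
  obtain ⟨q, hqp, hq, hA⟩ : ∃ q : unitInterval, (q : ℝ) ≤ p ∧ (p : ℝ) - q ≤ p - τ + 1 / √(N : ℝ) ∧
      3 / 4 ≤ (sampleLaw N q).real A := by
    have hinv : 0 < 1 / √(N : ℝ) := by positivity
    rcases le_total 0 (τ - 1 / √(N : ℝ)) with h | h
    · refine ⟨⟨τ - 1 / √(N : ℝ), h, by linarith⟩, ?_, ?_, ?_⟩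
      · dsimp only; linarith
      · dsimp only; linarith
      · exact three_quarters_le_sampleLaw N hN _ (by dsimp only; linarith)
    · refine ⟨0, by simpa using hp₀.le, ?_, ?_⟩
      · change (p : ℝ) - 0 ≤ _; linarith
      · have h1 : (sampleLaw N 0).real {fun _ => false} ≤ (sampleLaw N 0).real A := by
          refine measureReal_mono ?_
          rw [Set.singleton_subset_iff]
          simpa [A, rewardValue] using mul_nonneg hN'.le hτ₀
        rw [sampleLaw_real_singleton] at h1
        simp at h1
        linarith
  have hexp : (N : ℝ) * ((p - q : ℝ) ^ 2 / (p * (1 - p))) ≤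
      (√(N : ℝ) * (p - τ) + 1) ^ 2 / (p * (1 - p)) := by
    rw [← mul_div_assoc]
    refine div_le_div_of_nonneg_right ?_ (mul_pos hp₀ hp₁').le
    rw [show (N : ℝ) * (p - q : ℝ) ^ 2 = (√(N : ℝ) * (p - q)) ^ 2 by rw [mul_pow, hss]]
    refine pow_le_pow_left₀ (mul_nonneg hs.le (by linarith)) ?_ 2
    calc √(N : ℝ) * (p - q) ≤ √(N : ℝ) * (p - τ + 1 / √(N : ℝ)) :=
          mul_le_mul_of_nonneg_left hq hs.le
      _ = _ := by rw [mul_add, mul_one_div, div_self hs.ne']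
  have hmain := sampleLaw_real_sq_le N q hp₀ hp₁ A
  rw [Real.exp_neg, ← div_eq_mul_inv, div_le_iff₀ (Real.exp_pos _)]
  calc (9 / 16 : ℝ) ≤ (sampleLaw N q).real A ^ 2 := by nlinarith
    _ ≤ _ := hmain.trans (mul_le_mul_of_nonneg_left (Real.exp_le_exp.2 hexp) measureReal_nonneg)

/-! ### Survival of a random walk with small positive drift -/

/-- The exponential moment of a centred Bernoulli reward with positive drift `y`. -/
lemma exp_moment_le_one {p y : ℝ} (hp₀ : 0 ≤ p) (hp₁ : p ≤ 1) (hy₀ : 0 ≤ y) (hy₁ : y ≤ 1) :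
    p * Real.exp (-(y * (1 - (p - y)))) + (1 - p) * Real.exp (-(y * (0 - (p - y)))) ≤ 1 := by
  have h1 : Real.exp (-(y * (1 - (p - y)))) = Real.exp (-y) * Real.exp (y * (p - y)) := by
    rw [← Real.exp_add]; ring_nf
  have h2 : -(y * (0 - (p - y))) = y * (p - y) := by ring
  have h3 : Real.exp (-y) ≤ 1 - y + y ^ 2 := by
    have := (abs_le.1 (Real.abs_exp_sub_one_sub_id_le (x := -y) (by rw [abs_neg, abs_of_nonneg hy₀]; exact hy₁))).2
    nlinarith
  -- The left side is at most `1 - p * y + p * y ^ 2`; the drift `y` absorbs the quadratic term.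
  have h4 : p * Real.exp (-y) + (1 - p) ≤ Real.exp (-(y * (p - y))) := by
    have h5 := Real.add_one_le_exp (-(y * (p - y)))
    nlinarith [mul_le_mul_of_nonneg_left h3 hp₀, mul_nonneg (sub_nonneg.2 hp₁) (sq_nonneg y)]
  rw [h1, h2]
  calc _ = (p * Real.exp (-y) + (1 - p)) * Real.exp (y * (p - y)) := by ring
    _ ≤ Real.exp (-(y * (p - y))) * Real.exp (y * (p - y)) :=
      mul_le_mul_of_nonneg_right h4 (Real.exp_pos _).le
    _ = 1 := by rw [← Real.exp_add]; simp

/-- The survival potential of a random walk at height `w`. -/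
noncomputable def survival (y w : ℝ) : ℝ := max 0 (1 - Real.exp (-(y * w)))

lemma survival_nonneg (y w : ℝ) : 0 ≤ survival y w := le_max_left _ _

lemma le_survival (y w : ℝ) : 1 - Real.exp (-(y * w)) ≤ survival y w := le_max_right _ _

lemma survival_le_one (y w : ℝ) : survival y w ≤ 1 :=
  max_le zero_le_one (by linarith [Real.exp_pos (-(y * w))])

lemma survival_eq_zero {y w : ℝ} (hy : 0 ≤ y) (hw : w ≤ 0) : survival y w = 0 := by
  refine max_eq_left ?_
  have : 1 ≤ Real.exp (-(y * w)) := Real.one_le_exp (by nlinarith)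
  linarith

lemma survival_eq {y w : ℝ} (hy : 0 ≤ y) (hw : 0 ≤ w) :
    survival y w = 1 - Real.exp (-(y * w)) := by
  refine max_eq_right ?_
  have : Real.exp (-(y * w)) ≤ 1 := Real.exp_le_one_iff.2 (by nlinarith)
  linarith

/-- The survival potential does not decrease on average in one step of a walk with drift `y`. -/
lemma survival_le_step {p y w : ℝ} (hp₀ : 0 ≤ p) (hp₁ : p ≤ 1) (hy₀ : 0 ≤ y) (hy₁ : y ≤ 1)
    (hw : 0 ≤ w) :
    survival y w ≤ p * survival y (w + (1 - (p - y))) +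
      (1 - p) * survival y (w + (0 - (p - y))) := by
  have e : ∀ a : ℝ, Real.exp (-(y * (w + a))) = Real.exp (-(y * w)) * Real.exp (-(y * a)) := by
    intro a; rw [← Real.exp_add]; ring_nf
  have h1 := mul_le_mul_of_nonneg_left (le_survival y (w + (1 - (p - y)))) hp₀
  have h2 := mul_le_mul_of_nonneg_left (le_survival y (w + (0 - (p - y)))) (sub_nonneg.2 hp₁)
  have h3 := mul_le_mul_of_nonneg_left (exp_moment_le_one hp₀ hp₁ hy₀ hy₁)
    (Real.exp_pos (-(y * w))).le
  rw [survival_eq hy₀ hw]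
  rw [e] at h1 h2
  nlinarith

/-- The expected survival potential of the walk after the `N` initial samples is of order `y`. -/
lemma le_integral_survival (N : ℕ) (hN : 0 < N) (p : unitInterval) {y : ℝ} (hy₀ : 0 ≤ y)
    (hy₁ : y ≤ 1) :
    (p : ℝ) * (1 - Real.exp (-(y * (1 - (p - y))))) ≤
      ∫ ω, survival y (∑ i, rewardValue (ω i) - (p - y) * N) ∂(sampleLaw N p) := by
  obtain ⟨n, rfl⟩ : ∃ n, N = n + 1 := ⟨N - 1, by omega⟩
  have hp₀ := p.2.1
  have hp₁ := p.2.2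
  let g : Bool → ℝ := fun r => Real.exp (-(y * (rewardValue r - (p - y))))
  have hg : ∫ r, g r ∂(bernoulliMeasure true false p) ≤ 1 := by
    simpa [integral_bernoulliMeasure, g, rewardValue] using exp_moment_le_one hp₀ hp₁ hy₀ hy₁
  have hg₀ : 0 ≤ ∫ r, g r ∂(bernoulliMeasure true false p) :=
    integral_nonneg fun r => (Real.exp_pos _).le
  have hfirst : ∫ ω, rewardValue (ω 0) ∂(sampleLaw (n + 1) p) = p := by
    rw [← integral_rewardValue p]
    exact integral_comp_eval (μ := fun _ : Fin (n + 1) => bernoulliMeasure true false p)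
      (f := rewardValue) (Measurable.of_discrete).aestronglyMeasurable
  -- Only paths whose first sample is 1 are kept. That sample lifts the walk by `1 - (p - y)`, and
  -- the other samples contribute exponential moments at most 1. Without this restriction the bound
  -- would only be nonnegative.
  let f : Fin (n + 1) → Bool → ℝ := Fin.cons (fun r => rewardValue r * g r) fun _ => g
  have hprod : ∫ ω, ∏ i, f i (ω i) ∂(sampleLaw (n + 1) p) ≤
      p * Real.exp (-(y * (1 - (p - y)))) := by
    rw [sampleLaw, integral_fintype_prod_eq_prod, Fin.prod_univ_succ]
    simp only [f, Fin.cons_zero, Fin.cons_succ, Finset.prod_const]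
    have : ∫ r, rewardValue r * g r ∂(bernoulliMeasure true false p) =
        p * Real.exp (-(y * (1 - (p - y)))) := by
      simp [integral_bernoulliMeasure, g, rewardValue]
    rw [this]
    exact mul_le_of_le_one_right (mul_nonneg hp₀ (Real.exp_pos _).le) (pow_le_one₀ hg₀ hg)
  have hpt : ∀ ω : Fin (n + 1) → Bool, rewardValue (ω 0) - ∏ i, f i (ω i) ≤
      survival y (∑ i, rewardValue (ω i) - (p - y) * (n + 1 : ℕ)) := by
    intro ω
    have : ∏ i, f i (ω i) = rewardValue (ω 0) *
        Real.exp (-(y * (∑ i, rewardValue (ω i) - (p - y) * (n + 1 : ℕ)))) := by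
      have hexp : Real.exp (-(y * (∑ i, rewardValue (ω i) - (p - y) * (n + 1 : ℕ)))) =
          ∏ i, g (ω i) := by
        simp only [g]
        rw [← Real.exp_sum]
        congr 1
        rw [Finset.sum_neg_distrib, ← Finset.mul_sum, Finset.sum_sub_distrib]
        rw [Finset.sum_const, Finset.card_fin, nsmul_eq_mul, mul_comm (p - y : ℝ)]
      rw [hexp, Fin.prod_univ_succ, Fin.prod_univ_succ]
      simp [f, mul_assoc]
    rw [this]
    rcases h : ω 0 with _ | _
    · simpa [rewardValue] using survival_nonneg _ _
    · simpa [rewardValue] using le_survival y (∑ i, rewardValue (ω i) - (p - y) * (n + 1 : ℕ))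
  have hint := integral_mono (μ := sampleLaw (n + 1) p) Integrable.of_finite
    Integrable.of_finite hpt
  rw [integral_sub Integrable.of_finite Integrable.of_finite, hfirst] at hint
  linarith

/-! ### The potential along the protocol -/

/-- The histories in which the initial samples of the good arm average at most `τ` and all agents
chose the bad arm. -/
def stuck (N₀ t : ℕ) (τ : ℝ) : Set (History N₀ t) :=
  {h | ∑ i, rewardValue (h.1 goodArm i) ≤ N₀ * τ ∧ ∀ s, (h.2 s).1 = badArm}

/-- The excess of the total reward of the bad arm over `m` per sample, if only the bad arm has been
chosen. -/
noncomputable def excess {N₀ t : ℕ} (m : ℝ) (h : History N₀ t) : ℝ :=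
  ∑ i, rewardValue (h.1 badArm i) + ∑ s, rewardValue (h.2 s).2 - m * (N₀ + t : ℕ)

open Classical in
/-- A lower bound for the probability of the `0`-sampling failure given the history. -/
noncomputable def potential {N₀ t : ℕ} (τ m y : ℝ) (h : History N₀ t) : ENNReal :=
  if h ∈ stuck N₀ t τ then ENNReal.ofReal (survival y (excess m h)) else 0

/-- The bad arm has at least `N₀` samples, so both confidence radii are at most `√(η / N₀)` and fit
into the gap between `τ` and `m`. -/
lemma ucb_lt_lcb_of_stuck {N₀ t : ℕ} (hN : 0 < N₀) {η τ m : ℝ} (hη : 0 ≤ η)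
    (hτ : τ + 2 * √(η / N₀) ≤ m) {h : History N₀ t} (hs : h ∈ stuck N₀ t τ)
    (he : 0 < excess m h) : ucb η h goodArm < lcb η h badArm := by
  obtain ⟨h1, h2⟩ := hs
  have hN' : (0 : ℝ) < N₀ := by exact_mod_cast hN
  have hn0 : numSamples h goodArm = N₀ := by simp [numSamples, h2]
  have hn1 : numSamples h badArm = N₀ + t := by simp [numSamples, h2]
  have ha0 : avgReward h goodArm ≤ τ := by
    rw [avgReward, hn0, div_le_iff₀ hN']
    simpa [h2, mul_comm] using h1
  have ha1 : m < avgReward h badArm := by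
    rw [avgReward, hn1, lt_div_iff₀ (by push_cast; positivity)]
    rw [excess] at he
    simp only [h2, if_true]
    linarith
  have hr : √(η / (N₀ + t : ℕ)) ≤ √(η / N₀) := by
    refine Real.sqrt_le_sqrt (div_le_div_of_nonneg_left hη hN' ?_)
    push_cast
    linarith [(Nat.cast_nonneg t : (0 : ℝ) ≤ t)]
  refine (min_le_right _ _).trans_lt (lt_of_lt_of_le ?_ (le_max_right _ _))
  rw [hn0, hn1]
  linarith

/-- Submartingale step. Where the potential is positive the agent's choice is forced, so the excess
makes one step of the walk; elsewhere there is nothing to prove. -/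
lemma potential_le_lintegral_roundLaw {N₀ t : ℕ} (hN : 0 < N₀) {η τ y : ℝ} (hη : 0 ≤ η)
    (hy₀ : 0 ≤ y) (hy₁ : y ≤ 1) (μ : Fin 2 → unitInterval) {b : BehavioralType N₀ t}
    (hb : IsConfident η b) (hτ : τ + 2 * √(η / N₀) ≤ μ badArm - y) (h : History N₀ t) :
    potential τ (μ badArm - y) y h ≤
      ∫⁻ h', potential τ (μ badArm - y) y h' ∂(roundLaw μ b h) := by
  set m : ℝ := μ badArm - y with hm
  by_cases hs : h ∈ stuck N₀ t τ
  swap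
  · simp [potential, hs]
  by_cases he : 0 < excess m h
  swap
  · simp [potential, survival_eq_zero hy₀ (not_lt.1 he)]
  have hs' : ∀ r, ((h.1, Fin.snoc h.2 (badArm, r)) : History N₀ (t + 1)) ∈ stuck N₀ (t + 1) τ := by
    refine fun r => ⟨hs.1, fun s => ?_⟩
    refine Fin.lastCases ?_ (fun s => ?_) s
    · simp
    · simpa using hs.2 s
  have he' : ∀ r, excess m ((h.1, Fin.snoc h.2 (badArm, r)) : History N₀ (t + 1)) =
      excess m h + (rewardValue r - m) := by
    intro r
    simp only [excess, Fin.sum_univ_castSucc, Fin.snoc_castSucc, Fin.snoc_last]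
    push_cast
    ring
  rw [roundLaw_of_ucb_lt_lcb μ hb (ucb_lt_lcb_of_stuck hN hη hτ hs he),
    lintegral_map (Measurable.of_discrete) (Measurable.of_discrete), lintegral_bernoulliMeasure]
  simp only [potential, hs, hs', if_true, he']
  have hp₀ := (μ badArm).2.1
  have hp₁ := (μ badArm).2.2
  rw [← ENNReal.ofReal_mul hp₀, ← ENNReal.ofReal_mul (sub_nonneg.2 hp₁),
    ← ENNReal.ofReal_add (mul_nonneg hp₀ (survival_nonneg _ _))
      (mul_nonneg (sub_nonneg.2 hp₁) (survival_nonneg _ _))]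
  refine ENNReal.ofReal_le_ofReal ?_
  simpa [rewardValue, hm] using survival_le_step hp₀ hp₁ hy₀ hy₁ he.le

lemma lintegral_potential_zero_le {N₀ T : ℕ} (hN : 0 < N₀) {η τ y : ℝ} (hη : 0 ≤ η)
    (hy₀ : 0 ≤ y) (hy₁ : y ≤ 1) (μ : Fin 2 → unitInterval)
    {agents : (t : ℕ) → BehavioralType N₀ t} (hτ : τ + 2 * √(η / N₀) ≤ μ badArm - y)
    (hconf : ∀ t < T, IsConfident η (agents t)) :
    ∫⁻ h, potential τ (μ badArm - y) y h ∂(historyLaw μ agents 0) ≤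
      ∫⁻ h, potential τ (μ badArm - y) y h ∂(historyLaw μ agents T) := by
  induction T with
  | zero => exact le_rfl
  | succ T ih =>
    refine (ih fun t ht => hconf t (ht.trans (Nat.lt_succ_self T))).trans ?_
    rw [historyLaw, Measure.lintegral_bind (Measurable.of_discrete).aemeasurable
      (Measurable.of_discrete).aemeasurable]
    exact lintegral_mono fun h =>
      potential_le_lintegral_roundLaw hN hη hy₀ hy₁ μ (hconf T (Nat.lt_succ_self T)) hτ h

lemma lintegral_potential_le {N₀ T : ℕ} (τ m y : ℝ) (μ : Fin 2 → unitInterval)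
    (agents : (t : ℕ) → BehavioralType N₀ t) :
    ∫⁻ h, potential τ m y h ∂(historyLaw μ agents T) ≤
      historyLaw μ agents T (samplingFailure N₀ T 0) := by
  classical
  rw [← lintegral_indicator_one (Set.toFinite (samplingFailure N₀ T 0)).measurableSet]
  refine lintegral_mono fun h => ?_
  by_cases hs : h ∈ stuck N₀ T τ
  · have hf : h ∈ samplingFailure N₀ T 0 := by simp [samplingFailure, hs.2]
    simpa [potential, hs, hf] using survival_le_one _ _
  · simp [potential, hs]

/-- The initial samples of the two arms are independent, so the initial potential factorizes. -/
lemma lintegral_potential_zero_eq {N₀ : ℕ} (τ m y : ℝ) (μ : Fin 2 → unitInterval)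
    (agents : (t : ℕ) → BehavioralType N₀ t) :
    ∫⁻ h, potential τ m y h ∂(historyLaw μ agents 0) =
      ENNReal.ofReal ((sampleLaw N₀ (μ goodArm)).real {ω | ∑ i, rewardValue (ω i) ≤ N₀ * τ} *
        ∫ ω, survival y (∑ i, rewardValue (ω i) - m * N₀) ∂(sampleLaw N₀ (μ badArm))) := by
  classical
  set A : Set (Fin N₀ → Bool) := {ω | ∑ i, rewardValue (ω i) ≤ N₀ * τ} with hA
  let f : Fin 2 → (Fin N₀ → Bool) → ℝ := Fin.cons (A.indicator fun _ => 1)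
    fun _ ω => survival y (∑ i, rewardValue (ω i) - m * N₀)
  have hf : ∀ a ω, 0 ≤ f a ω := by
    intro a ω
    fin_cases a
    · exact Set.indicator_nonneg (fun _ _ => zero_le_one) _
    · exact survival_nonneg _ _
  have hpot : ∀ init : Fin 2 → Fin N₀ → Bool,
      potential τ m y ((init, Fin.elim0) : History N₀ 0) = ENNReal.ofReal (∏ a, f a (init a)) := by
    intro init
    have hmem : ((init, Fin.elim0) : History N₀ 0) ∈ stuck N₀ 0 τ ↔ init goodArm ∈ A := by
      simp [stuck, hA]
    by_cases h : init goodArm ∈ A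
    · simp [potential, hmem, h, f, Fin.prod_univ_two, excess]
    · simp [potential, hmem, h, f, Fin.prod_univ_two]
  rw [historyLaw, lintegral_map (Measurable.of_discrete) (Measurable.of_discrete)]
  simp only [hpot]
  rw [← ofReal_integral_eq_lintegral_ofReal Integrable.of_finite
    (ae_of_all _ fun init => Finset.prod_nonneg fun a _ => hf a _),
    integral_fintype_prod_eq_prod, Fin.prod_univ_two]
  congr 2
  exact integral_indicator_one (Set.toFinite A).measurableSet

/-- The probability of the `0`-sampling failure is at least the probability that the initial
samples of the good arm average at most `τ` times that of a walk with drift `y` staying positive. -/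
lemma le_samplingFailure {N₀ T : ℕ} (hN : 0 < N₀) {η τ y : ℝ} (hη : 0 ≤ η)
    (hy₀ : 0 ≤ y) (hy₁ : y ≤ 1) (μ : Fin 2 → unitInterval)
    {agents : (t : ℕ) → BehavioralType N₀ t} (hτ : τ + 2 * √(η / N₀) ≤ μ badArm - y)
    (hconf : ∀ t < T, IsConfident η (agents t)) :
    (sampleLaw N₀ (μ goodArm)).real {ω | ∑ i, rewardValue (ω i) ≤ N₀ * τ} *
        ((μ badArm : ℝ) * (1 - Real.exp (-(y * (1 - (μ badArm - y)))))) ≤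
      (historyLaw μ agents T).real (samplingFailure N₀ T 0) := by
  refine (mul_le_mul_of_nonneg_left (le_integral_survival N₀ hN (μ badArm) hy₀ hy₁)
    measureReal_nonneg).trans ?_
  rw [measureReal_def (historyLaw μ agents T), ← ENNReal.ofReal_le_iff_le_toReal (measure_ne_top _ _),
    ← lintegral_potential_zero_eq τ _ y μ agents]
  exact (lintegral_potential_zero_le hN hη hy₀ hy₁ μ hτ hconf).trans
    (lintegral_potential_le _ _ _ _ _)

/-! ### Choice of parameters -/

lemma half_le_one_sub_exp_neg {z : ℝ} (hz₀ : 0 ≤ z) (hz₁ : z ≤ 1 / 2) :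
    z / 2 ≤ 1 - Real.exp (-z) := by
  have h := (abs_le.1 (Real.abs_exp_sub_one_sub_id_le (x := -z)
    (by rw [abs_neg, abs_of_nonneg hz₀]; linarith))).2
  nlinarith

end BanditSocialLearning

open BanditSocialLearning in
theorem corollary3p3 (c : ℝ) (hc : c ∈ Set.Ioo (0 : ℝ) (1 / 2)) :
    ∃ C : ℝ, 0 < C ∧ ∀ K : ℝ, 0 < K → ∃ α : ℝ, 0 < α ∧
      ∀ (η : ℝ) (N₀ T : ℕ) (μ : Fin 2 → unitInterval)
        (agents : (t : ℕ) → BanditSocialLearning.BehavioralType N₀ t) (Δ pfail : ℝ),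
        0 ≤ η →
        c < μ BanditSocialLearning.badArm →
        (μ BanditSocialLearning.badArm : ℝ) < μ BanditSocialLearning.goodArm →
        (μ BanditSocialLearning.goodArm : ℝ) < 1 - c →
        64 * η / c ^ 2 + 1 / c ≤ N₀ →
        (∀ t < T, BanditSocialLearning.IsConfident η (agents t)) →
        Δ = (μ BanditSocialLearning.goodArm : ℝ) - μ BanditSocialLearning.badArm →
        Δ < K / √(N₀ : ℝ) →
        pfail = α * (Δ + √(η / N₀)) * Real.exp (-(C * η)) →
        pfail ≤ (BanditSocialLearning.historyLaw μ agents T).real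
            (BanditSocialLearning.samplingFailure N₀ T 0) ∧
          Δ * pfail * T ≤ BanditSocialLearning.regret μ agents T := by
  obtain ⟨hc₀, hc₁⟩ := hc
  -- The tail exponent is at most `((2K + 1) + 3√η)² / c²`, and `(a + b)² ≤ 2a² + 2b²` separates `K`
  -- from `η`. The factor `c ^ 3 / 8` comes from `hwalk`.
  refine ⟨18 / c ^ 2, by positivity, fun K hK =>
    ⟨9 / 16 * Real.exp (-(2 * (2 * K + 1) ^ 2 / c ^ 2)) * (c ^ 3 / 8), by positivity, ?_⟩⟩
  intro η N₀ T μ agents Δ pfail hη hμc hμ hμ1 hN₀ hconf hΔ hΔK hpfail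
  suffices hfail : pfail ≤ (historyLaw μ agents T).real (samplingFailure N₀ T 0) by
    refine ⟨hfail, le_trans ?_ (mul_samplingFailure_le_regret μ agents T hμ.le)⟩
    rw [← hΔ]
    exact mul_le_mul_of_nonneg_right (mul_le_mul_of_nonneg_left hfail (by linarith))
      (Nat.cast_nonneg T)
  have hNpos : (0 : ℝ) < N₀ := lt_of_lt_of_le (by positivity) hN₀
  have hN : 0 < N₀ := by exact_mod_cast hNpos
  have hs : 0 < √(N₀ : ℝ) := Real.sqrt_pos.2 hNpos
  have hΔ₀ : 0 < Δ := by linarith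
  have hΔ₁ : Δ < 1 := by linarith
  obtain ⟨r, hr⟩ : ∃ r, r = √(η / N₀) := ⟨_, rfl⟩
  have hr₀ : 0 ≤ r := hr ▸ Real.sqrt_nonneg _
  have hrc : r ≤ c / 8 := by
    rw [hr]
    refine Real.sqrt_le_iff.2 ⟨by positivity, ?_⟩
    rw [div_le_iff₀ hNpos]
    have h1 : 64 * η / c ^ 2 ≤ N₀ := le_trans (by simpa using hc₀.le) hN₀
    rw [div_le_iff₀ (by positivity)] at h1
    nlinarith
  have hsr : √(N₀ : ℝ) * r = √η := by
    rw [hr, Real.sqrt_div hη, mul_div_cancel₀ _ hs.ne']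
  have hsΔ : √(N₀ : ℝ) * Δ ≤ K := by
    rw [lt_div_iff₀ hs] at hΔK; linarith
  -- The factor `c / 4` gives `y ≤ c / 2`; with `2 * r ≤ c / 4` this keeps `τ` nonnegative. The
  -- level `τ` is the largest one allowing two radii below `μ badArm - y`.
  set y : ℝ := c / 4 * (Δ + r) with hy
  have hy₀ : 0 ≤ y := by positivity
  have hyc : y ≤ c / 2 := by
    calc y ≤ c / 4 * 2 := mul_le_mul_of_nonneg_left (by linarith) (by positivity)
      _ = c / 2 := by ring
  have hyΔ : y ≤ Δ + r := mul_le_of_le_one_left (by positivity) (by linarith)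
  set τ : ℝ := μ badArm - y - 2 * r with hτ
  have hτ₀ : 0 ≤ τ := by rw [hτ]; linarith
  have hτp : τ ≤ μ goodArm := by rw [hτ]; linarith
  have hchain := le_samplingFailure hN hη hy₀ (by linarith) μ (τ := τ)
    (by rw [← hr, hτ]; linarith) hconf
  have htail := exp_le_sampleLaw_lower_tail N₀ hN (p := μ goodArm) (by linarith) (by linarith)
    hτ₀ hτp
  have hwalk : c ^ 3 / 8 * (Δ + r) ≤
      (μ badArm : ℝ) * (1 - Real.exp (-(y * (1 - (μ badArm - y))))) := by
    have h1 : y * c ≤ y * (1 - (μ badArm - y)) := mul_le_mul_of_nonneg_left (by linarith) hy₀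
    have h2 : Real.exp (-(y * (1 - (μ badArm - y)))) ≤ Real.exp (-(y * c)) :=
      Real.exp_le_exp.2 (by linarith)
    have hyc₀ : 0 ≤ y * c := by positivity
    have hyc₁ : y * c ≤ 1 / 2 := mul_le_of_le_one_left hc₀.le (by linarith) |>.trans hc₁.le
    have h3 := half_le_one_sub_exp_neg hyc₀ hyc₁
    have h4 : y * c / 2 ≤ 1 - Real.exp (-(y * (1 - (μ badArm - y)))) := by linarith
    calc c ^ 3 / 8 * (Δ + r) = c * (y * c / 2) := by rw [hy]; ring
      _ ≤ _ := mul_le_mul hμc.le h4 (by positivity) (by linarith)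
  have hexp : Real.exp (-(2 * (2 * K + 1) ^ 2 / c ^ 2)) * Real.exp (-(18 / c ^ 2 * η)) ≤
      Real.exp (-((√(N₀ : ℝ) * (μ goodArm - τ) + 1) ^ 2 / (μ goodArm * (1 - μ goodArm)))) := by
    rw [← Real.exp_add]
    refine Real.exp_le_exp.2 ?_
    have h1 : √(N₀ : ℝ) * (μ goodArm - τ) ≤ 2 * K + 3 * √η := by
      calc √(N₀ : ℝ) * (μ goodArm - τ) ≤ √(N₀ : ℝ) * (2 * Δ + 3 * r) :=
            mul_le_mul_of_nonneg_left (by rw [hτ]; linarith) hs.le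
        _ = 2 * (√(N₀ : ℝ) * Δ) + 3 * (√(N₀ : ℝ) * r) := by ring
        _ ≤ _ := by rw [hsr]; linarith
    have h0 : 0 ≤ √(N₀ : ℝ) * (μ goodArm - τ) := mul_nonneg hs.le (by linarith)
    have h2 : (√(N₀ : ℝ) * (μ goodArm - τ) + 1) ^ 2 ≤ 2 * (2 * K + 1) ^ 2 + 18 * η := by
      have h3 : (√(N₀ : ℝ) * (μ goodArm - τ) + 1) ^ 2 ≤ ((2 * K + 1) + 3 * √η) ^ 2 :=
        pow_le_pow_left₀ (by linarith) (by linarith) 2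
      nlinarith [sq_nonneg ((2 * K + 1) - 3 * √η), Real.sq_sqrt hη]
    have h4 : c ^ 2 ≤ (μ goodArm : ℝ) * (1 - μ goodArm) := by
      rw [sq]
      exact mul_le_mul (by linarith) (by linarith) hc₀.le (by linarith)
    have h5 : (√(N₀ : ℝ) * (μ goodArm - τ) + 1) ^ 2 / (μ goodArm * (1 - μ goodArm)) ≤
        (2 * (2 * K + 1) ^ 2 + 18 * η) / c ^ 2 :=
      div_le_div₀ (by positivity) h2 (by positivity) h4
    rw [add_div] at h5
    have h6 : 18 / c ^ 2 * η = 18 * η / c ^ 2 := by ring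
    linarith
  rw [hpfail, ← hr]
  calc _ = 9 / 16 * (Real.exp (-(2 * (2 * K + 1) ^ 2 / c ^ 2)) * Real.exp (-(18 / c ^ 2 * η))) *
        (c ^ 3 / 8 * (Δ + r)) := by ring
    _ ≤ _ := mul_le_mul ((mul_le_mul_of_nonneg_left hexp (by norm_num)).trans htail) hwalk
        (by positivity) measureReal_nonneg
    _ ≤ _ := hchain
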